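/- Let $d\ge 1$ and let $I^d=I_1\times\dots\times I_d\subset\mathbb R^d$ be a bounded $d$-dimensional interval (each $I_k$ a bounded interval of $\mathbb R$) with its Borel $\sigma$-algebra, $\mu$ a probability measure on $I^d$, and $f:I^d\to I^d$ a measurable, $\mu$-preserving, ergodic map. Logarithms are to base 2, and $H$ denotes Shannon entropy, $H(Z)=-\sum_z \Pr(Z=z)\log_2\Pr(Z=z)$ with $0\log_2 0=0$. *Kolmogorov–Sinai entropy.* $h_\mu(f)=\sup_\alpha\lim_{L\to\infty}\frac1L H_\mu\big(\bigvee_{i=0}^{L-1}f^{-i}\alpha\big)\in[0,\infty]$, the supremum being over all finite measurable partitions $\alpha$ of $I^d$, where $H_\mu(\beta)=-\sum_{B\in\beta}\mu(B)\log_2\mu(B)$. *Permutation entropy rate of a process.* For a process $\mathbf S=(S_0,S_1,\dots)$ with values in a finite totally ordered alphabet, let $R_n=|\{0\le i\le n: S_i\le S_n\}|$. Its permutation entropy rate is $h^*(\mathbf S)=\lim_{L\to\infty}\frac1{L-1}H(R_0,\dots,R_{L-1})$, provided the limit exists. *Simple observations.* A product partition $\iota$ of $I^d$ is given by a partition of each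 side $I_k$ into finitely many nonempty subintervals; its cells are the products of these subintervals, ordered lexicographically with the last coordinate the most significant, and $\|\iota\|$ is the largest length of one of the subintervals. Let $S^\iota_n(x)$ be the cell of $\iota$ that contains $f^n(x)$, $n=0,1,\dots$, and let $\mathbf S^\iota=(S^\iota_n)$, a process on $(I^d,\mu)$. **Theorem.** For every product partition $\iota$ the permutation entropy rate $h^*(\mathbf S^\iota)$ exists (as a finite limit), and the permutation entropy rate of $f$, $$h^*_\mu(f):=\lim_{\|\iota\|\to0}h^*(\mathbf S^\iota),$$ exists in $[0,\infty]$ and equals the Kolmogorov–Sinai entropy: $h^*_\mu(f)=h_\mu(f)$ (both may be $\infty$). -/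

import Mathlib

open Filter Topology MeasureTheory

namespace PermEntropy

noncomputable section

/-- Shannon entropy, in bits, of a random variable `X` with values in a finite set: it is
`-∑ Pr(X = b) log₂ Pr(X = b)`, with `0 log₂ 0 = 0`. Equivalently, the entropy `H_μ(β)` of the finite
partition `β = {X = b}` (empty cells contribute nothing). -/
def shannonEntropy {Ω B : Type*} [MeasurableSpace Ω] [Fintype B] (μ : Measure Ω) (X : Ω → B) : ℝ :=
  -∑ b, μ.real (X ⁻¹' {b}) * Real.logb 2 (μ.real (X ⁻¹' {b}))

/-! ### Kolmogorov–Sinai entropy -/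

/-- The labelling of the refinement `⋁_{i < L} f⁻ⁱ α`, where the finite partition `α` is given by its
labelling map `α : Ω → Fin n`: the cells are the sets `⋂_{i < L} f⁻ⁱ A_{j i}`. -/
def itinerary {Ω : Type*} {n : ℕ} (f : Ω → Ω) (α : Ω → Fin n) (L : ℕ) : Ω → (Fin L → Fin n) :=
  fun x i => α (f^[i] x)

/-- `h_μ(f, α) = lim_L (1/L) H_μ(⋁_{i < L} f⁻ⁱ α)`. The limit exists by subadditivity whenever `f`
preserves the probability measure `μ`; it is written as an upper limit in the extended reals, so
that the expression has no junk value. -/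
def entropyOfPartition {Ω : Type*} [MeasurableSpace Ω] (μ : Measure Ω) (f : Ω → Ω) {n : ℕ}
    (α : Ω → Fin n) : EReal :=
  limsup (fun L : ℕ => ((1 / (L : ℝ) * shannonEntropy μ (itinerary f α L) : ℝ) : EReal)) atTop

/-- Kolmogorov–Sinai entropy `h_μ(f) = sup_α h_μ(f, α)`, over all finite measurable partitions `α`,
given by measurable labelling maps. Its value is in `[0, ∞]`. -/
def ksEntropy {Ω : Type*} [MeasurableSpace Ω] (μ : Measure Ω) (f : Ω → Ω) : EReal :=
  ⨆ (n : ℕ) (α : Ω → Fin n) (_ : Measurable α), entropyOfPartition μ f α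

/-! ### Permutation entropy of finite-alphabet processes -/

/-- The rank word `R_1 … R_L` of a word `s_1 … s_L` over an ordered alphabet:
`R_n` is the number of `i ≤ n` with `s_i ≤ s_n`. -/
def rankWord {A : Type*} [LinearOrder A] {L : ℕ} (s : Fin L → A) : Fin L → Fin (L + 1) :=
  fun n => ⟨(Finset.univ.filter fun i : Fin L => i ≤ n ∧ s i ≤ s n).card,
    Nat.lt_succ_of_le ((Finset.card_le_univ _).trans_eq (Fintype.card_fin L))⟩

/-- Permutation entropy of order `L` of the process `S_0, S_1, …`:
`(1/(L-1)) H(R_1 … R_L)`, for the rank word of the first `L` symbols (meaningful for `L ≥ 2`). -/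
def permEntropyOfOrder {Ω A : Type*} [MeasurableSpace Ω] [LinearOrder A] (μ : Measure Ω)
    (S : ℕ → Ω → A) (L : ℕ) : ℝ :=
  1 / ((L : ℝ) - 1) * shannonEntropy μ (fun ω => rankWord fun i : Fin L => S i ω)

/-- The permutation entropy rate of the process `S` exists and equals `h`. -/
def HasPermEntropyRate {Ω A : Type*} [MeasurableSpace Ω] [LinearOrder A] (μ : Measure Ω)
    (S : ℕ → Ω → A) (h : ℝ) : Prop :=
  Tendsto (fun L : ℕ => permEntropyOfOrder μ S L) atTop (𝓝 h)

/-! ### Product partitions of a `d`-dimensional interval -/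

/-- The `d`-dimensional interval with sides `I k`. -/
abbrev Box {d : ℕ} (I : Fin d → Set ℝ) : Set (Fin d → ℝ) := Set.univ.pi I

/-- A product partition of `Box I`: every side `I k` is partitioned into finitely many nonempty
subintervals `cell k 0 < cell k 1 < …`, listed from left to right. -/
structure ProductPartition {d : ℕ} (I : Fin d → Set ℝ) where
  /-- number of subintervals in coordinate `k` -/
  N : Fin d → ℕ
  /-- the subintervals in coordinate `k` -/
  cell : (k : Fin d) → Fin (N k) → Set ℝ
  nonempty : ∀ k j, (cell k j).Nonempty
  ordConnected : ∀ k j, (cell k j).OrdConnected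
  lt : ∀ k j j', j < j' → ∀ x ∈ cell k j, ∀ y ∈ cell k j', x < y
  iUnion_eq : ∀ k, ⋃ j, cell k j = I k

namespace ProductPartition

variable {d : ℕ} {I : Fin d → Set ℝ}

/-- The norm `‖ι‖`: the largest length of a subinterval. -/
def mesh (ι : ProductPartition I) : ℝ :=
  ⨆ p : (k : Fin d) × Fin (ι.N k), Metric.diam (ι.cell p.1 p.2)

/-- The alphabet of `ι`, i.e. its set of cells, each cell being given by the positions
of its sides. Cells are ordered lexicographically, the last coordinate being the most significant
one. -/
abbrev Alphabet (ι : ProductPartition I) : Type := Colex ((k : Fin d) → Fin (ι.N k))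

/-- The `d`-dimensional cell with a given index. -/
def boxCell (ι : ProductPartition I) (a : ι.Alphabet) : Set (Box I) :=
  {x | ∀ k, (x : Fin d → ℝ) k ∈ ι.cell k (ofColex a k)}

theorem existsUnique_mem_boxCell (ι : ProductPartition I) (x : Box I) :
    ∃! a, x ∈ ι.boxCell a := by
  have h : ∀ k, ∃ j, (x : Fin d → ℝ) k ∈ ι.cell k j := fun k => by
    have hx := x.2 k (Set.mem_univ k)
    rw [← ι.iUnion_eq k] at hx
    exact Set.mem_iUnion.1 hx
  choose j hj using h
  refine ⟨toColex j, fun k => hj k, fun a ha => ?_⟩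
  apply ofColex.injective
  funext k
  rcases lt_trichotomy (ofColex a k) (j k) with h | h | h
  · exact absurd (ι.lt k _ _ h _ (ha k) _ (hj k)) (lt_irrefl _)
  · exact h
  · exact absurd (ι.lt k _ _ h _ (hj k) _ (ha k)) (lt_irrefl _)

/-- The index of the cell which contains `x`. -/
def index (ι : ProductPartition I) (x : Box I) : ι.Alphabet :=
  (ι.existsUnique_mem_boxCell x).choose

theorem mem_boxCell_iff (ι : ProductPartition I) (x : Box I) (a : ι.Alphabet) :
    x ∈ ι.boxCell a ↔ ι.index x = a := by
  have h := (ι.existsUnique_mem_boxCell x).choose_spec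
  constructor
  · intro hx
    exact (h.2 a hx).symm
  · rintro rfl
    exact h.1

/-- The simple observations `S_n^ι(x)`: the index of the cell of `ι` which contains `f^n(x)`. -/
def simpleObservation (ι : ProductPartition I) (f : Box I → Box I) (n : ℕ) (x : Box I) :
    ι.Alphabet :=
  ι.index (f^[n] x)

/-- The filter of product partitions whose norm tends to `0`. -/
def meshFilter (I : Fin d → Set ℝ) : Filter (ProductPartition I) :=
  comap mesh (𝓝 0)

/-- A bounded interval has product partitions of arbitrarily small norm. -/
theorem meshFilter_neBot (hI : ∀ k, (I k).OrdConnected)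
    (hb : ∀ k, Bornology.IsBounded (I k)) : (meshFilter I).NeBot := by
  classical
  rw [meshFilter, comap_neBot_iff]
  intro t ht
  obtain ⟨ε, hε, hεt⟩ := Metric.mem_nhds_iff.1 ht
  set δ := ε / 2 with hδ
  have hδ0 : 0 < δ := by positivity
  let g : ℝ → ℤ := fun x => ⌊x / δ⌋
  have hg : Monotone g := fun x y hxy => Int.floor_mono (by gcongr)
  have hfin : ∀ k, (g '' I k).Finite := fun k => by
    obtain ⟨a, ha⟩ := (hb k).bddBelow
    obtain ⟨b, hb'⟩ := (hb k).bddAbove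
    refine (Set.finite_Icc (g a) (g b)).subset ?_
    rintro _ ⟨x, hx, rfl⟩
    exact ⟨hg (ha hx), hg (hb' hx)⟩
  let T : Fin d → Finset ℤ := fun k => (hfin k).toFinset
  let e : (k : Fin d) → Fin (T k).card ↪o ℤ := fun k => (T k).orderEmbOfFin rfl
  have hdiam : ∀ k (j : Fin (T k).card), Metric.diam {x ∈ I k | g x = e k j} ≤ δ := by
    intro k j
    refine Metric.diam_le_of_forall_dist_le hδ0.le ?_
    rintro x ⟨-, hx⟩ y ⟨-, hy⟩
    have h := Int.abs_sub_lt_one_of_floor_eq_floor (hx.trans hy.symm)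
    rw [← sub_div, abs_div, abs_of_pos hδ0, div_lt_one hδ0] at h
    exact h.le
  let ι : ProductPartition I :=
    { N := fun k => (T k).card
      cell := fun k j => {x ∈ I k | g x = e k j}
      nonempty := fun k j => by
        have : e k j ∈ T k := Finset.orderEmbOfFin_mem _ _ _
        obtain ⟨x, hx, hxe⟩ := (hfin k).mem_toFinset.1 this
        exact ⟨x, hx, hxe⟩
      ordConnected := fun k j => by
        refine ⟨?_⟩
        rintro x ⟨hx, hx'⟩ y ⟨hy, hy'⟩ z ⟨hz, hz'⟩
        refine ⟨(hI k).out hx hy ⟨hz, hz'⟩, le_antisymm ?_ ?_⟩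
        · exact hy' ▸ hg hz'
        · exact hx' ▸ hg hz
      lt := fun k j j' hjj x hx y hy => by
        refine hg.reflect_lt ?_
        rw [hx.2, hy.2]
        exact (e k).strictMono hjj
      iUnion_eq := fun k => by
        ext x
        simp only [Set.mem_iUnion, Set.mem_ofPred_eq]
        refine ⟨fun ⟨_, h, _⟩ => h, fun hx => ?_⟩
        have hmem : g x ∈ Set.range (e k) := by
          have := Finset.range_orderEmbOfFin (T k) rfl
          rw [this]
          exact (hfin k).mem_toFinset.2 ⟨x, hx, rfl⟩
        obtain ⟨j, hj⟩ := hmem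
        exact ⟨j, hx, hj.symm⟩ }
  refine ⟨ι, hεt ?_⟩
  have h1 : ι.mesh ≤ δ := Real.iSup_le (fun p => hdiam p.1 p.2) hδ0.le
  have h0 : 0 ≤ ι.mesh := Real.iSup_nonneg fun p => Metric.diam_nonneg
  rw [Metric.mem_ball, Real.dist_0_eq_abs, abs_of_nonneg h0]
  linarith

end ProductPartition

/-- The permutation entropy rate `h*_μ(f)` of `f` exists and equals `h`, where `h` may be `∞`:
for every product partition `ι` the process `S^ι` of simple observations has a permutation entropy
rate, and these rates tend to `h` as the norm of `ι` tends to `0`. -/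
def HasMapPermEntropyRate {d : ℕ} {I : Fin d → Set ℝ} (μ : Measure (Box I)) (f : Box I → Box I)
    (h : EReal) : Prop :=
  ∃ r : ProductPartition I → ℝ,
    (∀ ι, HasPermEntropyRate μ (ι.simpleObservation f) (r ι)) ∧
    Tendsto (fun ι => (r ι : EReal)) (ProductPartition.meshFilter I) (𝓝 h)

end

end PermEntropy

/-!
For a stationary process with finite ordered alphabet `A`, the permutation entropy rate is the
entropy rate. The rank word of `L` symbols is a function of the symbols. Conversely it determines
how the symbols are sorted (ties being broken by order of appearance), so together with the number
of occurrences of each letter it determines the symbols themselves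
(`rankWord_cumulativeCount_injective`). There are at most `(L + 1) ^ |A|` vectors of letter counts,
so the entropies of the rank word and of the symbol word differ by at most `|A| log₂ (L + 1)`, which
is negligible against `L` (`hasPermEntropyRate_entropyRate`). The entropy rate itself exists by
Fekete's lemma.

It remains to see that the entropy rates of product partitions tend to the Kolmogorov–Sinai entropy
as the mesh tends to `0`. They never exceed it. Given a finite measurable partition `α`, inner
regularity provides disjoint compact subsets of its cells that carry almost all the mass; a product
partition `ι` of small mesh separates them, so `α` is a function of the index of `ι` outside an
event of small probability (`ProductPartition.exists_approx`). The variable `E` that corrects the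
errors is almost constant and has small entropy, and subadditivity gives
`h(f, α) ≤ h(f, ι) + H(E)` (`entropyRate_le_add`).
-/

namespace PermEntropy

/-! ### Shannon entropy of finite-valued random variables -/

section Entropy

variable {Ω B C : Type*} [MeasurableSpace Ω]

/-- A map with values in a finite set is treated as a random variable when all its preimages are
measurable, i.e. when it is measurable for the discrete σ-algebra of its codomain. -/
def DiscreteMeasurable (X : Ω → B) : Prop :=
  ∀ s : Set B, MeasurableSet (X ⁻¹' s)

theorem discreteMeasurable_of_singleton [Finite B] {X : Ω → B}
    (h : ∀ b, MeasurableSet (X ⁻¹' {b})) : DiscreteMeasurable X := by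
  intro s
  rw [← Set.biUnion_preimage_singleton]
  exact MeasurableSet.biUnion s.to_countable fun b _ => h b

theorem DiscreteMeasurable.comp {X : Ω → B} (hX : DiscreteMeasurable X) (g : B → C) :
    DiscreteMeasurable fun x => g (X x) :=
  fun s => hX (g ⁻¹' s)

theorem DiscreteMeasurable.comp_measurable {X : Ω → B} (hX : DiscreteMeasurable X) {f : Ω → Ω}
    (hf : Measurable f) : DiscreteMeasurable fun x => X (f x) :=
  fun s => hf (hX s)

theorem DiscreteMeasurable.pi {ι : Type*} [Finite ι] [Finite B] {X : ι → Ω → B}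
    (hX : ∀ i, DiscreteMeasurable (X i)) : DiscreteMeasurable fun x i => X i x := by
  refine discreteMeasurable_of_singleton fun b => ?_
  have : (fun x i => X i x) ⁻¹' {b} = ⋂ i, X i ⁻¹' {b i} := by
    ext x
    simp [funext_iff]
  rw [this]
  exact MeasurableSet.iInter fun i => hX i _

theorem DiscreteMeasurable.prodMk [Finite B] [Finite C] {X : Ω → B} {Y : Ω → C}
    (hX : DiscreteMeasurable X) (hY : DiscreteMeasurable Y) :
    DiscreteMeasurable fun x => (X x, Y x) := by
  refine discreteMeasurable_of_singleton fun b => ?_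
  have : (fun x => (X x, Y x)) ⁻¹' {b} = X ⁻¹' {b.1} ∩ Y ⁻¹' {b.2} := by
    ext x
    simp [Prod.ext_iff]
  rw [this]
  exact (hX _).inter (hY _)

variable [Fintype B] [Fintype C] {μ : Measure Ω}

/-- The law of `g X` is the image under `g` of the law of `X`. -/
theorem sum_law_comp [IsFiniteMeasure μ] {X : Ω → B} (hX : DiscreteMeasurable X) (g : B → C)
    (F : C → ℝ) :
    ∑ b, μ.real (X ⁻¹' {b}) * F (g b) = ∑ c, μ.real ((fun x => g (X x)) ⁻¹' {c}) * F c := by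
  classical
  rw [← Finset.sum_fiberwise Finset.univ g]
  refine Finset.sum_congr rfl fun c _ => ?_
  have h : (fun x => g (X x)) ⁻¹' {c} = X ⁻¹' ↑(Finset.univ.filter fun b => g b = c) := by
    ext x
    simp
  rw [h, ← sum_measureReal_preimage_singleton _ fun b _ => hX {b}, Finset.sum_mul]
  exact Finset.sum_congr rfl fun b hb => by rw [(Finset.mem_filter.1 hb).2]

theorem sum_law [IsProbabilityMeasure μ] {X : Ω → B} (hX : DiscreteMeasurable X) :
    ∑ b, μ.real (X ⁻¹' {b}) = 1 := by
  have := sum_measureReal_preimage_singleton (μ := μ) (f := X) Finset.univ fun b _ => hX {b}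
  simpa using this

theorem shannonEntropy_nonneg [IsProbabilityMeasure μ] (X : Ω → B) : 0 ≤ shannonEntropy μ X := by
  rw [shannonEntropy, ← Finset.sum_neg_distrib]
  refine Finset.sum_nonneg fun b _ => ?_
  exact neg_nonneg.2 (mul_nonpos_of_nonneg_of_nonpos measureReal_nonneg
    (Real.logb_nonpos one_lt_two measureReal_nonneg measureReal_le_one))

/-- Gibbs' inequality. -/
theorem shannonEntropy_le_crossEntropy [IsProbabilityMeasure μ] {X : Ω → B}
    (hX : DiscreteMeasurable X) {q : B → ℝ} (hq : ∀ b, 0 ≤ q b) (hq1 : ∑ b, q b ≤ 1)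
    (hac : ∀ b, q b = 0 → μ.real (X ⁻¹' {b}) = 0) :
    shannonEntropy μ X ≤ -∑ b, μ.real (X ⁻¹' {b}) * Real.logb 2 (q b) := by
  have hl : 0 < Real.log 2 := Real.log_pos one_lt_two
  have key : ∀ b, μ.real (X ⁻¹' {b}) * Real.logb 2 (q b) ≤
      μ.real (X ⁻¹' {b}) * Real.logb 2 (μ.real (X ⁻¹' {b})) +
        (q b - μ.real (X ⁻¹' {b})) / Real.log 2 := by
    intro b
    set p := μ.real (X ⁻¹' {b}) with hp
    have hp0 : 0 ≤ p := measureReal_nonneg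
    rcases hp0.eq_or_lt with h | h
    · simpa [← h] using div_nonneg (hq b) hl.le
    · have hqb : 0 < q b := (hq b).lt_of_ne fun h' => h.ne' (hac b h'.symm)
      have h1 := Real.log_le_sub_one_of_pos (div_pos hqb h)
      rw [Real.log_div hqb.ne' h.ne'] at h1
      have h2 : p * (Real.log (q b) - Real.log p) ≤ q b - p := by
        calc p * (Real.log (q b) - Real.log p) ≤ p * (q b / p - 1) := by gcongr
          _ = q b - p := by field_simp
      simp only [Real.logb]
      rw [← mul_div_assoc, ← mul_div_assoc, ← add_div]
      gcongr
      linarith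
  have hsum := Finset.sum_le_sum fun b (_ : b ∈ Finset.univ) => key b
  rw [Finset.sum_add_distrib, ← Finset.sum_div, Finset.sum_sub_distrib, sum_law hX] at hsum
  have : (∑ b, q b - 1) / Real.log 2 ≤ 0 :=
    div_nonpos_of_nonpos_of_nonneg (by linarith) hl.le
  rw [shannonEntropy]
  linarith

theorem shannonEntropy_le_logb_card [IsProbabilityMeasure μ] {X : Ω → B}
    (hX : DiscreteMeasurable X) : shannonEntropy μ X ≤ Real.logb 2 (Fintype.card B) := by
  have : Nonempty B := μ.nonempty_of_neZero.map X
  have hc : (0 : ℝ) < Fintype.card B := by exact_mod_cast Fintype.card_pos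
  refine (shannonEntropy_le_crossEntropy hX (q := fun _ => (Fintype.card B : ℝ)⁻¹)
    (fun _ => by positivity) (by simp) fun b hb => absurd hb (by positivity)).trans_eq ?_
  rw [← Finset.sum_mul, sum_law hX, Real.logb_inv]
  ring

theorem shannonEntropy_comp_le [IsProbabilityMeasure μ] {X : Ω → B} (hX : DiscreteMeasurable X)
    (g : B → C) : shannonEntropy μ (fun x => g (X x)) ≤ shannonEntropy μ X := by
  rw [shannonEntropy, ← sum_law_comp hX g fun c =>
    Real.logb 2 (μ.real ((fun x => g (X x)) ⁻¹' {c})), shannonEntropy, neg_le_neg_iff]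
  refine Finset.sum_le_sum fun b _ => ?_
  rcases (measureReal_nonneg (μ := μ) (s := X ⁻¹' {b})).eq_or_lt with h | h
  · simp [← h]
  · refine mul_le_mul_of_nonneg_left (Real.logb_le_logb_of_le one_lt_two h ?_) h.le
    refine measureReal_mono fun x hx => ?_
    rw [Set.mem_preimage, Set.mem_singleton_iff] at hx ⊢
    rw [hx]

theorem shannonEntropy_prodMk_le [IsProbabilityMeasure μ] {X : Ω → B} {Y : Ω → C}
    (hX : DiscreteMeasurable X) (hY : DiscreteMeasurable Y) :
    shannonEntropy μ (fun x => (X x, Y x)) ≤ shannonEntropy μ X + shannonEntropy μ Y := by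
  have hXY := hX.prodMk hY
  have h1 := sum_law_comp (μ := μ) hXY Prod.fst fun b => Real.logb 2 (μ.real (X ⁻¹' {b}))
  have h2 := sum_law_comp (μ := μ) hXY Prod.snd fun b => Real.logb 2 (μ.real (Y ⁻¹' {b}))
  have hle1 : ∀ b : B × C, μ.real ((fun x => (X x, Y x)) ⁻¹' {b}) ≤ μ.real (X ⁻¹' {b.1}) :=
    fun b => measureReal_mono fun x hx => congrArg Prod.fst hx
  have hle2 : ∀ b : B × C, μ.real ((fun x => (X x, Y x)) ⁻¹' {b}) ≤ μ.real (Y ⁻¹' {b.2}) :=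
    fun b => measureReal_mono fun x hx => congrArg Prod.snd hx
  refine (shannonEntropy_le_crossEntropy hXY
    (q := fun b => μ.real (X ⁻¹' {b.1}) * μ.real (Y ⁻¹' {b.2}))
    (fun b => by positivity) ?_ ?_).trans_eq ?_
  · rw [Fintype.sum_prod_type]
    dsimp only
    rw [← Fintype.sum_mul_sum, sum_law hX, sum_law hY, one_mul]
  · intro b hb
    rcases mul_eq_zero.1 hb with h | h
    · exact le_antisymm (h ▸ hle1 b) measureReal_nonneg
    · exact le_antisymm (h ▸ hle2 b) measureReal_nonneg
  · rw [shannonEntropy, shannonEntropy, ← h1, ← h2, ← neg_add, ← Finset.sum_add_distrib]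
    congr 1
    refine Finset.sum_congr rfl fun b _ => ?_
    rcases (measureReal_nonneg (μ := μ) (s := (fun x => (X x, Y x)) ⁻¹' {b})).eq_or_lt with h | h
    · simp [← h]
    · rw [Real.logb_mul (h.trans_le (hle1 b)).ne' (h.trans_le (hle2 b)).ne', mul_add]

theorem shannonEntropy_comp_measurePreserving {X : Ω → B} (hX : DiscreteMeasurable X) {f : Ω → Ω}
    (hf : MeasurePreserving f μ μ) : shannonEntropy μ (fun x => X (f x)) = shannonEntropy μ X := by
  have : ∀ b, μ.real ((fun x => X (f x)) ⁻¹' {b}) = μ.real (X ⁻¹' {b}) := fun b =>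
    hf.measureReal_preimage (hX {b}).nullMeasurableSet
  simp only [shannonEntropy, this]

/-- A random variable that takes one distinguished value `none` with probability close to `1` has
small entropy, by continuity of `p ↦ -p log p`. -/
theorem exists_shannonEntropy_option_lt (μ : Measure Ω) [IsProbabilityMeasure μ] (B : Type*)
    [Fintype B] {ε : ℝ} (hε : 0 < ε) :
    ∃ η > 0, ∀ E : Ω → Option B, DiscreteMeasurable E →
      (∀ b, μ.real (E ⁻¹' {some b}) < η) → shannonEntropy μ E < ε := by
  let F : (B → ℝ) → ℝ := fun p =>
    (Real.negMulLog (1 - ∑ b, p b) + ∑ b, Real.negMulLog (p b)) / Real.log 2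
  have hF : Continuous F := by
    have := Real.continuous_negMulLog
    fun_prop
  have hF0 : F 0 = 0 := by simp [F]
  obtain ⟨η, hη, h⟩ := Metric.continuousAt_iff.1 (hF.continuousAt (x := 0)) ε hε
  refine ⟨η, hη, fun E hE hEη => ?_⟩
  have hnone : μ.real (E ⁻¹' {none}) = 1 - ∑ b, μ.real (E ⁻¹' {some b}) := by
    rw [← sum_law (μ := μ) hE, Fintype.sum_option]
    ring
  have hEF : shannonEntropy μ E = F fun b => μ.real (E ⁻¹' {some b}) := by
    simp only [shannonEntropy, F, Fintype.sum_option, hnone, Real.logb, Real.negMulLog, add_div,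
      Finset.sum_div, neg_add, ← Finset.sum_neg_distrib]
    congr 1
    · ring
    · exact Finset.sum_congr rfl fun b _ => by ring
  have h' := @h (fun b => μ.real (E ⁻¹' {some b})) <| by
    rw [dist_pi_lt_iff hη]
    intro b
    rw [Pi.zero_apply, Real.dist_0_eq_abs, abs_of_nonneg measureReal_nonneg]
    exact hEη b
  rw [hF0, Real.dist_0_eq_abs] at h'
  rw [hEF]
  exact lt_of_abs_lt h'

end Entropy

/-! ### Entropy rates -/

section Rate

variable {Ω A B : Type*} [MeasurableSpace Ω] [Fintype A] [Fintype B] {μ : Measure Ω} {f : Ω → Ω}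

/-- Entropy of the first `L` symbols of the process `α, α ∘ f, α ∘ f², …`. -/
noncomputable def blockEntropy (μ : Measure Ω) (f : Ω → Ω) (α : Ω → A) (L : ℕ) : ℝ :=
  shannonEntropy μ fun x (i : Fin L) => α (f^[i] x)

theorem DiscreteMeasurable.block {α : Ω → A} (hα : DiscreteMeasurable α) (hf : Measurable f)
    (L : ℕ) : DiscreteMeasurable fun x (i : Fin L) => α (f^[i] x) :=
  .pi fun i => hα.comp_measurable (hf.iterate i)

theorem blockEntropy_nonneg [IsProbabilityMeasure μ] (α : Ω → A) (L : ℕ) :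
    0 ≤ blockEntropy μ f α L :=
  shannonEntropy_nonneg _

theorem blockEntropy_subadditive [IsProbabilityMeasure μ] (hf : MeasurePreserving f μ μ)
    {α : Ω → A} (hα : DiscreteMeasurable α) : Subadditive (blockEntropy μ f α) := by
  intro m n
  have hm := hα.block hf.measurable m
  have hn := hα.block hf.measurable n
  have hn' := hn.comp_measurable (hf.measurable.iterate m)
  have h : (fun x (i : Fin (m + n)) => α (f^[i] x)) = fun x =>
      (fun p : (Fin m → A) × (Fin n → A) => Fin.append p.1 p.2)
        (fun i : Fin m => α (f^[i] x), fun i : Fin n => α (f^[i] (f^[m] x))) := by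
    funext x i
    refine Fin.addCases (fun i => ?_) (fun i => ?_) i
    · simp
    · simp [← Function.iterate_add_apply, add_comm]
  calc blockEntropy μ f α (m + n)
      ≤ shannonEntropy μ (fun x => (fun i : Fin m => α (f^[i] x),
          fun i : Fin n => α (f^[i] (f^[m] x)))) := by
        rw [blockEntropy, h]
        exact shannonEntropy_comp_le (hm.prodMk hn')
          fun p : (Fin m → A) × (Fin n → A) => Fin.append p.1 p.2
    _ ≤ blockEntropy μ f α m + shannonEntropy μ (fun x (i : Fin n) => α (f^[i] (f^[m] x))) :=
        shannonEntropy_prodMk_le hm hn'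
    _ = blockEntropy μ f α m + blockEntropy μ f α n := by
        rw [shannonEntropy_comp_measurePreserving hn (hf.iterate m)]
        rfl

/-- The entropy rate of the process `α, α ∘ f, α ∘ f², …`. The limit exists by subadditivity when
`f` preserves the probability measure `μ` and `α` is measurable. -/
noncomputable def entropyRate (μ : Measure Ω) (f : Ω → Ω) (α : Ω → A) : ℝ :=
  limUnder atTop fun L : ℕ => blockEntropy μ f α L / L

theorem bddBelow_blockEntropy_div [IsProbabilityMeasure μ] (α : Ω → A) :
    BddBelow (Set.range fun L : ℕ => blockEntropy μ f α L / L) :=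
  ⟨0, by rintro _ ⟨L, rfl⟩; exact div_nonneg (blockEntropy_nonneg _ _) L.cast_nonneg⟩

theorem tendsto_blockEntropy_div [IsProbabilityMeasure μ] (hf : MeasurePreserving f μ μ)
    {α : Ω → A} (hα : DiscreteMeasurable α) :
    Tendsto (fun L : ℕ => blockEntropy μ f α L / L) atTop (𝓝 (entropyRate μ f α)) :=
  tendsto_nhds_limUnder
    ⟨_, (blockEntropy_subadditive hf hα).tendsto_lim (bddBelow_blockEntropy_div α)⟩

theorem entropyOfPartition_eq_entropyRate [IsProbabilityMeasure μ] (hf : MeasurePreserving f μ μ)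
    {n : ℕ} {α : Ω → Fin n} (hα : DiscreteMeasurable α) :
    entropyOfPartition μ f α = (entropyRate μ f α : EReal) := by
  refine Tendsto.limsup_eq ?_
  refine (continuous_coe_real_ereal.tendsto _).comp ?_
  refine (tendsto_blockEntropy_div hf hα).congr fun L => ?_
  rw [div_eq_inv_mul, one_div]
  rfl

theorem blockEntropy_le_of_comp [IsProbabilityMeasure μ] (hf : Measurable f) {α : Ω → A}
    (hα : DiscreteMeasurable α) (g : A → B) (L : ℕ) :
    blockEntropy μ f (fun x => g (α x)) L ≤ blockEntropy μ f α L :=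
  shannonEntropy_comp_le (hα.block hf L) fun w i => g (w i)

theorem blockEntropy_prodMk_le [IsProbabilityMeasure μ] (hf : Measurable f) {α : Ω → A}
    {β : Ω → B} (hα : DiscreteMeasurable α) (hβ : DiscreteMeasurable β) (L : ℕ) :
    blockEntropy μ f (fun x => (α x, β x)) L ≤ blockEntropy μ f α L + blockEntropy μ f β L :=
  (shannonEntropy_comp_le ((hα.block hf L).prodMk (hβ.block hf L))
    fun p i => (p.1 i, p.2 i)).trans (shannonEntropy_prodMk_le (hα.block hf L) (hβ.block hf L))

theorem entropyRate_comp_le [IsProbabilityMeasure μ] (hf : MeasurePreserving f μ μ) {α : Ω → A}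
    (hα : DiscreteMeasurable α) (g : A → B) :
    entropyRate μ f (fun x => g (α x)) ≤ entropyRate μ f α :=
  le_of_tendsto_of_tendsto' (tendsto_blockEntropy_div hf (hα.comp g))
    (tendsto_blockEntropy_div hf hα) fun L =>
      div_le_div_of_nonneg_right (blockEntropy_le_of_comp hf.measurable hα g L) L.cast_nonneg

theorem entropyRate_prodMk_le [IsProbabilityMeasure μ] (hf : MeasurePreserving f μ μ) {α : Ω → A}
    {β : Ω → B} (hα : DiscreteMeasurable α) (hβ : DiscreteMeasurable β) :
    entropyRate μ f (fun x => (α x, β x)) ≤ entropyRate μ f α + entropyRate μ f β :=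
  le_of_tendsto_of_tendsto' (tendsto_blockEntropy_div hf (hα.prodMk hβ))
    ((tendsto_blockEntropy_div hf hα).add (tendsto_blockEntropy_div hf hβ)) fun L => by
      rw [← add_div]
      exact div_le_div_of_nonneg_right (blockEntropy_prodMk_le hf.measurable hα hβ L)
        L.cast_nonneg

theorem entropyRate_le_shannonEntropy [IsProbabilityMeasure μ]
    (hf : MeasurePreserving f μ μ) {α : Ω → A} (hα : DiscreteMeasurable α) :
    entropyRate μ f α ≤ shannonEntropy μ α := by
  have h1 : blockEntropy μ f α 1 ≤ shannonEntropy μ α := by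
    have : (fun x (i : Fin 1) => α (f^[i] x)) = fun x => (fun a (_ : Fin 1) => a) (α x) := by
      funext x i
      simp
    rw [blockEntropy, this]
    exact shannonEntropy_comp_le hα fun a (_ : Fin 1) => a
  have hsub := blockEntropy_subadditive hf hα
  have hb := bddBelow_blockEntropy_div (μ := μ) (f := f) α
  rw [tendsto_nhds_unique (tendsto_blockEntropy_div hf hα) (hsub.tendsto_lim hb)]
  exact (hsub.lim_le_div hb one_ne_zero).trans (by simpa using h1)

/-- When `α` is predicted from `β` as `g ∘ β`, its entropy rate exceeds that of `β` by at most the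
entropy of the variable that records `α` where the prediction fails and is `none` elsewhere: this
variable and `β` together determine `α`. -/
theorem entropyRate_le_add [IsProbabilityMeasure μ] [DecidableEq A] (hf : MeasurePreserving f μ μ)
    {α : Ω → A} {β : Ω → B} (hα : DiscreteMeasurable α) (hβ : DiscreteMeasurable β) (g : B → A) :
    entropyRate μ f α ≤ entropyRate μ f β +
      shannonEntropy μ fun x => if α x = g (β x) then none else some (α x) := by
  set E : Ω → Option A := fun x => if α x = g (β x) then none else some (α x)
  have hE : DiscreteMeasurable E :=
    (hα.prodMk hβ).comp fun p => if p.1 = g p.2 then none else some p.1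
  let G : B × Option A → A := fun p => p.2.getD (g p.1)
  have h : α = fun x => G (β x, E x) := by
    funext x
    by_cases hx : α x = g (β x) <;> simp [G, E, hx]
  calc entropyRate μ f α = entropyRate μ f fun x => G (β x, E x) := congrArg (entropyRate μ f) h
    _ ≤ entropyRate μ f fun x => (β x, E x) := entropyRate_comp_le hf (hβ.prodMk hE) G
    _ ≤ entropyRate μ f β + entropyRate μ f E := entropyRate_prodMk_le hf hβ hE
    _ ≤ entropyRate μ f β + shannonEntropy μ E := by
      gcongr
      exact entropyRate_le_shannonEntropy hf hE

end Rate

/-! ### Rank words -/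

section Rank

variable {A : Type*} [LinearOrder A] {L : ℕ}

/-- The rank word determines the order of any two letters, the earlier one being listed first. If
the orders of the letters before position `j` agree in `s` and `t`, the sets of `i ≤ j` with
`s i ≤ s j` and with `t i ≤ t j` are lower sets of one total preorder, so that they coincide as soon
as they are equinumerous. -/
theorem le_iff_le_of_rankWord_eq {s t : Fin L → A} (h : rankWord s = rankWord t) (j : Fin L) :
    ∀ i ≤ j, (s i ≤ s j ↔ t i ≤ t j) := by
  induction j using WellFoundedLT.induction with
  | ind j ih =>
  have hcard : (Finset.univ.filter fun i : Fin L => i ≤ j ∧ s i ≤ s j).card =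
      (Finset.univ.filter fun i : Fin L => i ≤ j ∧ t i ≤ t j).card :=
    congrArg Fin.val (congrFun h j)
  suffices hD : (Finset.univ.filter fun i : Fin L => i ≤ j ∧ s i ≤ s j) =
      (Finset.univ.filter fun i : Fin L => i ≤ j ∧ t i ≤ t j) by
    intro i hi
    simpa [hi] using Finset.ext_iff.1 hD i
  by_contra hne
  obtain ⟨a, ha, ha'⟩ := Finset.not_subset.1 fun hs =>
    hne (Finset.eq_of_subset_of_card_le hs hcard.ge)
  obtain ⟨b, hb, hb'⟩ := Finset.not_subset.1 fun hs =>
    hne (Finset.eq_of_subset_of_card_le hs hcard.le).symm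
  simp only [Finset.mem_filter, Finset.mem_univ, true_and, not_and, not_le] at ha ha' hb hb'
  have hta := ha' ha.1
  have hsb := hb' hb.1
  have haj : a < j := ha.1.lt_of_ne (by rintro rfl; exact lt_irrefl _ hta)
  have hbj : b < j := hb.1.lt_of_ne (by rintro rfl; exact lt_irrefl _ hsb)
  rcases le_total a b with hab | hab
  · have := (ih b hbj a hab).1 (ha.2.trans hsb.le)
    exact absurd (hb.2.trans_lt hta) this.not_gt
  · have := (ih a haj b hab).2 (hb.2.trans hta.le)
    exact absurd (ha.2.trans_lt hsb) this.not_gt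

/-- The cumulative letter counts of a word: `a ↦ #{i | s i ≤ a}`. -/
def cumulativeCount (s : Fin L → A) (a : A) : Fin (L + 1) :=
  ⟨(Finset.univ.filter fun i => s i ≤ a).card,
    Nat.lt_succ_of_le ((Finset.card_le_univ _).trans_eq (Fintype.card_fin L))⟩

/-- The position of index `n` when the letters of `s` are sorted, equal letters being listed in
order of appearance. -/
def sortedPosition (s : Fin L → A) (n : Fin L) : ℕ :=
  (Finset.univ.filter fun i => (i ≤ n ∧ s i ≤ s n) ∨ (n < i ∧ s i < s n)).card

theorem le_iff_sortedPosition_le (s : Fin L → A) (n : Fin L) (a : A) :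
    s n ≤ a ↔ sortedPosition s n ≤ cumulativeCount s a := by
  simp only [sortedPosition, cumulativeCount]
  constructor
  · intro h
    refine Finset.card_le_card fun i hi => ?_
    simp only [Finset.mem_filter, Finset.mem_univ, true_and] at hi ⊢
    rcases hi with hi | hi
    · exact hi.2.trans h
    · exact hi.2.le.trans h
  · intro h
    by_contra! hlt
    refine absurd h (Finset.card_lt_card (Finset.ssubset_iff_of_subset ?_ |>.2 ?_)).not_ge
    · intro i hi
      simp only [Finset.mem_filter, Finset.mem_univ, true_and] at hi ⊢
      have := hi.trans_lt hlt
      rcases le_or_gt i n with hin | hin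
      · exact Or.inl ⟨hin, this.le⟩
      · exact Or.inr ⟨hin, this⟩
    · exact ⟨n, by simp, by simpa using hlt⟩

theorem sortedPosition_eq_of_rankWord_eq {s t : Fin L → A} (h : rankWord s = rankWord t) :
    sortedPosition s = sortedPosition t := by
  funext n
  refine congrArg Finset.card (Finset.filter_congr fun i _ => or_congr ?_ ?_)
  · exact and_congr_right fun hi => le_iff_le_of_rankWord_eq h n i hi
  · refine and_congr_right fun hi => ?_
    rw [← not_le, ← not_le, le_iff_le_of_rankWord_eq h i n hi.le]

/-- A word is determined by its rank word and its cumulative letter counts. -/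
theorem rankWord_cumulativeCount_injective :
    Function.Injective fun s : Fin L → A => (rankWord s, cumulativeCount s) := by
  intro s t h
  obtain ⟨hr, hc⟩ := Prod.ext_iff.1 h
  have key : ∀ n a, s n ≤ a ↔ t n ≤ a := fun n a => by
    rw [le_iff_sortedPosition_le s, le_iff_sortedPosition_le t,
      sortedPosition_eq_of_rankWord_eq hr, show cumulativeCount s = cumulativeCount t from hc]
  funext n
  exact le_antisymm ((key n _).2 le_rfl) ((key n _).1 le_rfl)

variable {Ω : Type*} [MeasurableSpace Ω] {μ : Measure Ω} [IsProbabilityMeasure μ]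

theorem shannonEntropy_rankWord_le [Fintype A] {S : Ω → Fin L → A} (hS : DiscreteMeasurable S) :
    shannonEntropy μ (fun x => rankWord (S x)) ≤ shannonEntropy μ S :=
  shannonEntropy_comp_le hS rankWord

/-- A rank word loses only logarithmically many bits, because there are at most `(L + 1) ^ |A|`
vectors of letter counts. -/
theorem shannonEntropy_le_rankWord_add [Fintype A] {S : Ω → Fin L → A}
    (hS : DiscreteMeasurable S) :
    shannonEntropy μ S ≤ shannonEntropy μ (fun x => rankWord (S x)) +
      Fintype.card A * Real.logb 2 (L + 1) := by
  have hr := hS.comp rankWord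
  have hc := hS.comp cumulativeCount
  have : Nonempty (Fin L → A) := μ.nonempty_of_neZero.map S
  have hinv : S = fun x => Function.invFun (fun s : Fin L → A => (rankWord s, cumulativeCount s))
      (rankWord (S x), cumulativeCount (S x)) := by
    funext x
    exact (Function.leftInverse_invFun rankWord_cumulativeCount_injective (S x)).symm
  classical
  calc shannonEntropy μ S = _ := congrArg _ hinv
    _ ≤ _ := shannonEntropy_comp_le (hr.prodMk hc) _
    _ ≤ _ := shannonEntropy_prodMk_le hr hc
    _ ≤ _ := by
      gcongr
      refine (shannonEntropy_le_logb_card hc).trans_eq ?_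
      rw [Fintype.card_fun, Fintype.card_fin, Nat.cast_pow, Real.logb_pow]
      push_cast
      rfl

/-- The permutation entropy rate of a stationary process with finite ordered alphabet is its entropy
rate. -/
theorem hasPermEntropyRate_entropyRate [Fintype A] {f : Ω → Ω} (hf : MeasurePreserving f μ μ)
    {α : Ω → A} (hα : DiscreteMeasurable α) :
    HasPermEntropyRate μ (fun n x => α (f^[n] x)) (entropyRate μ f α) := by
  have hinv : Tendsto (fun L : ℕ => 1 / ((L : ℝ) - 1)) atTop (𝓝 0) :=
    tendsto_const_nhds.div_atTop
      (tendsto_atTop_add_const_right _ (-1) tendsto_natCast_atTop_atTop)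
  have hratio : Tendsto (fun L : ℕ => (L : ℝ) / ((L : ℝ) - 1)) atTop (𝓝 1) := by
    have := hinv.const_add 1
    rw [add_zero] at this
    refine this.congr' ?_
    filter_upwards [eventually_gt_atTop 1] with L hL
    have : (L : ℝ) - 1 ≠ 0 := (sub_pos.2 (by exact_mod_cast hL)).ne'
    field_simp
    ring
  have hupper : Tendsto (fun L : ℕ => 1 / ((L : ℝ) - 1) * blockEntropy μ f α L) atTop
      (𝓝 (entropyRate μ f α)) := by
    have := hratio.mul (tendsto_blockEntropy_div hf hα)
    rw [one_mul] at this
    refine this.congr' ?_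
    filter_upwards [eventually_ge_atTop 1] with L hL
    have : (L : ℝ) ≠ 0 := by positivity
    field_simp
  have hlog : Tendsto (fun L : ℕ => 1 / ((L : ℝ) - 1) *
      (Fintype.card A * Real.logb 2 (L + 1))) atTop (𝓝 0) := by
    have h := (Real.isLittleO_log_id_atTop.tendsto_div_nhds_zero.comp
      ((tendsto_natCast_atTop_atTop (R := ℝ)).atTop_add tendsto_const_nhds (C := 1))).mul
        ((hratio.add hinv).mul_const (Fintype.card A / Real.log 2))
    rw [zero_mul] at h
    refine h.congr fun L => ?_
    have : (L : ℝ) + 1 ≠ 0 := by positivity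
    simp only [Function.comp_apply, id, Real.logb, ← add_div]
    field_simp
  have hlower := hupper.sub hlog
  rw [sub_zero] at hlower
  refine tendsto_of_tendsto_of_tendsto_of_le_of_le' hlower hupper ?_ ?_ <;>
    filter_upwards [eventually_ge_atTop 1] with L hL
  all_goals
    have hL' : 0 ≤ 1 / ((L : ℝ) - 1) := by
      have : (1 : ℝ) ≤ L := by exact_mod_cast hL
      exact one_div_nonneg.2 (by linarith)
  · rw [← mul_sub]
    refine mul_le_mul_of_nonneg_left ?_ hL'
    have := shannonEntropy_le_rankWord_add (μ := μ) (hα.block hf.measurable L)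
    exact sub_le_iff_le_add.2 this
  · exact mul_le_mul_of_nonneg_left
      (shannonEntropy_rankWord_le (hα.block hf.measurable L)) hL'

end Rank

/-! ### Product partitions of small mesh -/

namespace ProductPartition

variable {d : ℕ} {I : Fin d → Set ℝ}

theorem measurableSet_box (hI : ∀ k, (I k).OrdConnected) : MeasurableSet (Box I) :=
  MeasurableSet.univ_pi fun k => (hI k).measurableSet

instance (ι : ProductPartition I) : Fintype ι.Alphabet :=
  Fintype.ofEquiv _ toColex

theorem discreteMeasurable_index (ι : ProductPartition I) : DiscreteMeasurable ι.index := by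
  refine discreteMeasurable_of_singleton (B := ι.Alphabet) fun a => ?_
  have : ι.index ⁻¹' {a} = ⋂ k, {x : Box I | (x : Fin d → ℝ) k ∈ ι.cell k (ofColex a k)} := by
    ext x
    rw [Set.mem_preimage, Set.mem_singleton_iff, ← ι.mem_boxCell_iff]
    simp [boxCell]
  rw [this]
  refine MeasurableSet.iInter fun k => ?_
  exact ((measurable_pi_apply k).comp measurable_subtype_coe) (ι.ordConnected k _).measurableSet

theorem dist_le_mesh (hIb : ∀ k, Bornology.IsBounded (I k)) (ι : ProductPartition I) {x y : Box I}
    (h : ι.index x = ι.index y) : dist (x : Fin d → ℝ) y ≤ ι.mesh := by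
  have h0 : 0 ≤ ι.mesh := Real.iSup_nonneg fun p => Metric.diam_nonneg
  rw [dist_pi_le_iff h0]
  intro k
  have hx := (ι.mem_boxCell_iff x _).2 rfl k
  have hy := (ι.mem_boxCell_iff y _).2 rfl k
  rw [← h] at hy
  have hb : Bornology.IsBounded (ι.cell k (ofColex (ι.index x) k)) :=
    (hIb k).subset (ι.iUnion_eq k ▸ Set.subset_iUnion (ι.cell k) _)
  exact (Metric.dist_le_diam_of_mem hb hx hy).trans
    (le_ciSup (f := fun p : (k : Fin d) × Fin (ι.N k) => Metric.diam (ι.cell p.1 p.2))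
      (Set.finite_range _).bddAbove ⟨k, ofColex (ι.index x) k⟩)

/-- Every finite measurable partition is, up to small probability, coarser than each product
partition of small enough mesh. Its cells contain compact sets of almost full measure; these have
positive distance from each other, so that a small box meets at most one of them. -/
theorem exists_approx (hI : ∀ k, (I k).OrdConnected) (hIb : ∀ k, Bornology.IsBounded (I k))
    (μ : Measure (Box I)) [IsProbabilityMeasure μ] {B : Type*} [Finite B] {α : Box I → B}
    (hα : DiscreteMeasurable α) {η : ℝ} (hη : 0 < η) :
    ∃ δ > 0, ∀ ι : ProductPartition I, ι.mesh < δ →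
      ∃ g : ι.Alphabet → B, ∀ b, μ.real {x | α x = b ∧ g (ι.index x) ≠ b} < η := by
  have hemb := MeasurableEmbedding.subtype_coe (measurableSet_box hI)
  have := Measure.isProbabilityMeasure_map (μ := μ) hemb.measurable.aemeasurable
  have hK : ∀ b, ∃ K ⊆ ((↑) : Box I → Fin d → ℝ) '' (α ⁻¹' {b}), IsCompact K ∧
      μ.map (↑) (((↑) : Box I → Fin d → ℝ) '' (α ⁻¹' {b}) \ K) < ENNReal.ofReal η := fun b =>
    (hemb.measurableSet_image.2 (hα {b})).exists_isCompact_sdiff_lt (measure_ne_top _ _)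
      (by simpa using hη)
  choose K hKα hKc hKη using hK
  have hdisj : ∀ b b', b ≠ b' → Disjoint (K b) (K b') := fun b b' hbb' => by
    refine Set.disjoint_left.2 fun x hx hx' => hbb' ?_
    obtain ⟨y, hy, rfl⟩ := hKα b hx
    obtain ⟨z, hz, hzy⟩ := hKα b' hx'
    rw [Subtype.coe_injective hzy] at hz
    exact hy.symm.trans hz
  have hsep : ∀ᶠ δ in 𝓝[>] (0 : ℝ), ∀ b b', b ≠ b' →
      ∀ x ∈ K b, ∀ y ∈ K b', δ ≤ dist x y := by
    refine eventually_all.2 fun b => eventually_all.2 fun b' => ?_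
    by_cases hbb' : b = b'
    · simp [hbb']
    obtain ⟨δ, hδ, hd⟩ := (hdisj b b' hbb').exists_thickenings (hKc b) (hKc b').isClosed
    filter_upwards [Ioo_mem_nhdsGT hδ] with ε hε _ x hx y hy
    by_contra! hlt
    refine Set.disjoint_left.1 hd ?_ (Metric.self_subset_thickening hδ _ hy)
    exact Metric.mem_thickening_iff.2 ⟨x, hx, by rw [dist_comm]; exact hlt.trans hε.2⟩
  obtain ⟨δ, hδ, hδ0⟩ := (hsep.and self_mem_nhdsWithin).exists
  refine ⟨δ, hδ0, fun ι hι => ?_⟩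
  classical
  have : Nonempty B := μ.nonempty_of_neZero.map α
  -- `P a b`: the box with index `a` meets `K b`; each such `a` is sent to this `b`
  let P : ι.Alphabet → B → Prop := fun a b => ∃ x : Box I, ι.index x = a ∧ (x : Fin d → ℝ) ∈ K b
  refine ⟨fun a => if h : ∃ b, P a b then h.choose else Classical.arbitrary B, fun b => ?_⟩
  have hsub : {x | α x = b ∧ (if h : ∃ b, P (ι.index x) b then h.choose
      else Classical.arbitrary B) ≠ b} ⊆
      ((↑) : Box I → Fin d → ℝ) ⁻¹' (((↑) : Box I → Fin d → ℝ) '' (α ⁻¹' {b}) \ K b) := by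
    rintro x ⟨hx, hne⟩
    refine ⟨⟨x, hx, rfl⟩, fun hxK => hne ?_⟩
    have hex : ∃ b, P (ι.index x) b := ⟨b, x, rfl, hxK⟩
    rw [dif_pos hex]
    obtain ⟨y, hy, hyK⟩ := hex.choose_spec
    by_contra hb
    exact absurd (hδ _ _ hb _ hyK _ hxK) ((dist_le_mesh hIb ι hy).trans_lt hι).not_ge
  refine (measureReal_mono hsub).trans_lt ?_
  rw [measureReal_def, ← hemb.map_apply]
  exact (ENNReal.lt_ofReal_iff_toReal_lt (measure_ne_top _ _)).1 (hKη b)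

end ProductPartition

/-! ### Kolmogorov–Sinai entropy as a limit along product partitions -/

section Limit

variable {d : ℕ} {I : Fin d → Set ℝ} {μ : Measure (Box I)} [IsProbabilityMeasure μ]
  {f : Box I → Box I}

theorem entropyRate_le_ksEntropy {Ω A : Type*} [MeasurableSpace Ω] [Fintype A] {μ : Measure Ω}
    [IsProbabilityMeasure μ] {f : Ω → Ω} (hf : MeasurePreserving f μ μ) {α : Ω → A}
    (hα : DiscreteMeasurable α) : (entropyRate μ f α : EReal) ≤ ksEntropy μ f := by
  -- `ksEntropy` ranges over partitions labelled by `Fin n`, so the cells of `α` are enumerated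
  let e := Fintype.equivFin A
  have he := hα.comp e
  have h : entropyRate μ f α ≤ entropyRate μ f fun x => e (α x) := by
    simpa using entropyRate_comp_le hf he e.symm
  calc (entropyRate μ f α : EReal) ≤ (entropyRate μ f fun x => e (α x) : ℝ) := by exact_mod_cast h
    _ = entropyOfPartition μ f fun x => e (α x) := (entropyOfPartition_eq_entropyRate hf he).symm
    _ ≤ _ := by
      refine le_iSup_of_le (Fintype.card A) ?_
      exact le_iSup₂ (f := fun (β : Ω → Fin (Fintype.card A)) (_ : Measurable β) =>
        entropyOfPartition μ f β) (fun x => e (α x)) fun s _ => he s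

theorem eventually_entropyRate_le_index_add (hI : ∀ k, (I k).OrdConnected)
    (hIb : ∀ k, Bornology.IsBounded (I k)) (hf : MeasurePreserving f μ μ) {A : Type*} [Fintype A]
    {α : Box I → A} (hα : DiscreteMeasurable α) {ε : ℝ} (hε : 0 < ε) :
    ∀ᶠ ι in ProductPartition.meshFilter I,
      entropyRate μ f α < entropyRate μ f ι.index + ε := by
  classical
  obtain ⟨η, hη, hE⟩ := exists_shannonEntropy_option_lt μ A hε
  obtain ⟨δ, hδ, happrox⟩ := ProductPartition.exists_approx hI hIb μ hα hη
  filter_upwards [preimage_mem_comap (Iio_mem_nhds hδ)] with ι hι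
  obtain ⟨g, hg⟩ := happrox ι hι
  have hι := ι.discreteMeasurable_index
  refine (entropyRate_le_add hf hα hι g).trans_lt ?_
  gcongr
  refine hE _ ((hα.prodMk hι).comp fun p => if p.1 = g p.2 then none else some p.1) fun b => ?_
  refine (measureReal_mono fun x hx => ?_).trans_lt (hg b)
  rw [Set.mem_preimage, Set.mem_singleton_iff] at hx
  split_ifs at hx with h
  rw [← Option.some.inj hx]
  exact ⟨rfl, Ne.symm h⟩

theorem tendsto_entropyRate_index (hI : ∀ k, (I k).OrdConnected)
    (hIb : ∀ k, Bornology.IsBounded (I k)) (hf : MeasurePreserving f μ μ) :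
    Tendsto (fun ι : ProductPartition I => (entropyRate μ f ι.index : EReal))
      (ProductPartition.meshFilter I) (𝓝 (ksEntropy μ f)) := by
  refine tendsto_order.2 ⟨fun c hc => ?_, fun c hc => .of_forall fun ι =>
    (entropyRate_le_ksEntropy hf ι.discreteMeasurable_index).trans_lt hc⟩
  simp only [ksEntropy, lt_iSup_iff] at hc
  obtain ⟨n, α, hα, hc⟩ := hc
  have hα' : DiscreteMeasurable α := fun s => hα (MeasurableSet.of_discrete)
  rw [entropyOfPartition_eq_entropyRate hf hα'] at hc
  obtain ⟨c', hcc', hc'⟩ := EReal.lt_iff_exists_real_btwn.1 hc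
  rw [EReal.coe_lt_coe_iff] at hc'
  filter_upwards [eventually_entropyRate_le_index_add hI hIb hf hα' (sub_pos.2 hc')] with ι hι
  refine hcc'.trans (EReal.coe_lt_coe_iff.2 ?_)
  linarith

end Limit

end PermEntropy

theorem theorem3 {d : ℕ} (hd : 1 ≤ d) (I : Fin d → Set ℝ)
    (hI : ∀ k, (I k).OrdConnected) (hIb : ∀ k, Bornology.IsBounded (I k))
    (μ : MeasureTheory.Measure (PermEntropy.Box I)) [MeasureTheory.IsProbabilityMeasure μ]
    (f : PermEntropy.Box I → PermEntropy.Box I) (hf : Ergodic f μ) :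
    PermEntropy.HasMapPermEntropyRate μ f (PermEntropy.ksEntropy μ f) :=
  ⟨fun ι => PermEntropy.entropyRate μ f ι.index,
    fun ι => PermEntropy.hasPermEntropyRate_entropyRate hf.toMeasurePreserving
      ι.discreteMeasurable_index,
    PermEntropy.tendsto_entropyRate_index hI hIb hf.toMeasurePreserving⟩
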